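/- An edge-ordered graph is a finite simple graph together with a total order on its edge set. A copy of an edge-ordered graph $F$ in an edge-ordered graph $H$ is given by an injective map $V(F)\to V(H)$ that sends edges to edges and preserves the order of the edges; a perfect $F$-tiling in $H$ is a collection of pairwise vertex-disjoint copies of $F$ in $H$ that together cover all vertices of $H$. An edge-ordered graph $F$ on $f$ vertices is tileable if there is a positive integer $t$ divisible by $f$ such that $K_t$, under every total ordering of its edges, contains a perfect $F$-tiling. For $n\ge 3$, a monotone cycle of length $n$ is an edge-ordered cycle with vertices $u_1,\dots,u_n$ and edges ordered as $u_1u_2<u_2u_3<\dots<u_{n-1}u_n<u_nu_1$. Proposition. For every odd $n\ge 3$, every monotone cycle of length $n$ is tileable. -/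

import Mathlib

/-- An edge-ordered graph on the vertex set `V`: a simple graph together with a total order on its
set of edges. -/
structure EdgeOrderedGraph (V : Type*) where
  /-- the underlying graph -/
  graph : SimpleGraph V
  /-- the total order on the edges -/
  edgeOrder : LinearOrder graph.edgeSet

namespace EdgeOrderedGraph

/-- `F.Less e₁ e₂`: both `e₁` and `e₂` are edges of `F`, and `e₁` is smaller than `e₂` in the total
order of the edges of `F`. -/
def Less {V : Type*} (F : EdgeOrderedGraph V) (e₁ e₂ : Sym2 V) : Prop :=
  ∃ (h₁ : e₁ ∈ F.graph.edgeSet) (h₂ : e₂ ∈ F.graph.edgeSet), F.edgeOrder.lt ⟨e₁, h₁⟩ ⟨e₂, h₂⟩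

/-- An embedding of `F` into `H` (that is, a copy of `F` in `H`): an injective map on the vertices
(not necessarily induced) that sends edges to edges and preserves the order of the edges. -/
structure Embedding {V W : Type*} (F : EdgeOrderedGraph V) (H : EdgeOrderedGraph W) extends
    SimpleGraph.Copy F.graph H.graph where
  map_less : ∀ e₁ e₂ : Sym2 V, F.Less e₁ e₂ → H.Less (e₁.map toHom) (e₂.map toHom)

/-- `H` has a perfect `F`-tiling: a collection of pairwise vertex-disjoint copies of `F` in `H`
that covers all vertices of `H`. -/
def HasPerfectTiling {V W : Type*} (F : EdgeOrderedGraph V) (H : EdgeOrderedGraph W) : Prop :=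
  ∃ T : Set (F.Embedding H),
    T.PairwiseDisjoint (fun φ => Set.range φ.toHom) ∧ (⋃ φ ∈ T, Set.range φ.toHom) = Set.univ

/-- `F` is tileable: there is a positive `t` divisible by the number of vertices of `F` such that
every edge-ordering of the complete graph `K_t` contains a perfect `F`-tiling. -/
def Tileable {V : Type*} [Fintype V] (F : EdgeOrderedGraph V) : Prop :=
  ∃ t : ℕ, 0 < t ∧ Fintype.card V ∣ t ∧
    ∀ o : LinearOrder (⊤ : SimpleGraph (Fin t)).edgeSet, F.HasPerfectTiling ⟨⊤, o⟩

/-- `F` is a monotone cycle of length `n`: its vertices can be enumerated (without repetition) as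
`u 0, …, u (n - 1)` so that the underlying graph of `F` is the cycle through them in this cyclic
order, and the edges satisfy
`u 0 u 1 < u 1 u 2 < ⋯ < u (n - 2) u (n - 1) < u (n - 1) u 0`.
Here `finRotate n i` is the cyclic successor of `i`. -/
def IsMonotoneCycle {V : Type*} (F : EdgeOrderedGraph V) (n : ℕ) : Prop :=
  3 ≤ n ∧ ∃ u : SimpleGraph.cycleGraph n ≃g F.graph, ∀ i j : Fin n, i < j →
    F.Less s(u i, u (finRotate n i)) s(u j, u (finRotate n j))

end EdgeOrderedGraph

/-! Write `n = 2k + 1`. By Ramsey's theorem for triples, a huge ordered vertex set contains a large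
`A` on which the comparison of two edges of a triangle depends only on whether their common vertex
is its smallest, middle or largest one. Tiles are removed greedily from the complement of `A` until
a bounded set `L` is left. Each vertex of `L` is then absorbed into a tile with `2k` vertices of
`A`. What remains of `A` has size divisible by `n`, and any `n` vertices of `A` span a monotone
cycle.

The core is the absorption (`hasMonotoneCycle_insert`). Given `x` outside `A`, Ramsey for pairs
yields `2k` vertices of `A` on which the comparisons in triangles through `x` are uniform as well.
Split them into a lower and an upper half. Zigzagging between suitably ordered halves gives a
monotone path through all of them, starting in either half, and in every case one of the two paths
closes up through `x`. -/

open Finset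

/-! ### Ramsey's theorem and uniform comparisons -/

/-- Finite Ramsey theorem for increasing `r`-tuples in a linear order. -/
theorem exists_ramsey_tuple {κ : Type*} [Fintype κ] [Nonempty κ] (r m : ℕ) :
    ∃ N : ℕ, ∀ (α : Type) [LinearOrder α] (S : Finset α), N ≤ S.card →
      ∀ c : (Fin r → α) → κ, ∃ T ⊆ S, T.card = m ∧
        ∃ k, ∀ u : Fin r → α, StrictMono u → (∀ i, u i ∈ T) → c u = k := by
  classical
  induction r generalizing m with
  | zero =>
    refine ⟨m, fun α _ S hS c => ?_⟩
    obtain ⟨T, hT, hm⟩ := exists_subset_card_eq hS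
    exact ⟨T, hT, hm, c Fin.elim0, fun u _ _ => congrArg c (Subsingleton.elim _ _)⟩
  | succ r ih =>
    -- First make the colour depend on the least entry only: peel off the minimum `x` and apply the
    -- case `r` to the tuples that follow it. Pigeonhole on `f` then finishes.
    have key : ∀ m : ℕ, ∃ N : ℕ, ∀ (α : Type) [LinearOrder α] (S : Finset α), N ≤ S.card →
        ∀ c : (Fin (r + 1) → α) → κ, ∃ T ⊆ S, T.card = m ∧
          ∃ f : α → κ, ∀ u : Fin (r + 1) → α, StrictMono u → (∀ i, u i ∈ T) → c u = f (u 0) := by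
      intro m
      induction m with
      | zero =>
        refine ⟨0, fun α _ S _ c => ⟨∅, by simp, by simp, fun _ => Classical.arbitrary κ,
          fun u _ hu => absurd (hu 0) (by simp)⟩⟩
      | succ m ihm =>
        obtain ⟨N, hN⟩ := ihm
        obtain ⟨N', hN'⟩ := ih N
        refine ⟨N' + 1, fun α _ S hS c => ?_⟩
        have hne : S.Nonempty := card_pos.mp (by omega)
        set x := S.min' hne with hx
        have hxS : x ∈ S := S.min'_mem hne
        obtain ⟨S', hS', hc', k, hk⟩ := hN' α (S.erase x) (by rw [card_erase_of_mem hxS]; omega)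
          (fun u => c (Fin.cons x u))
        obtain ⟨T, hT, hTc, f, hf⟩ := hN α S' hc'.ge c
        have hlt : ∀ y ∈ T, x < y := fun y hy => by
          have h := mem_erase.mp (hS' (hT hy))
          exact lt_of_le_of_ne (S.min'_le y h.2) (Ne.symm h.1)
        have hxT : x ∉ T := fun h => (hlt x h).false
        refine ⟨insert x T, ?_, by rw [card_insert_of_notMem hxT, hTc],
          Function.update f x k, fun u hu huT => ?_⟩
        · exact insert_subset hxS ((hT.trans hS').trans (erase_subset _ _))
        · have htail : ∀ i : Fin r, u i.succ ∈ T := fun i => by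
            rcases mem_insert.mp (huT i.succ) with h | h
            · have h1 : u 0 < x := h ▸ hu (Fin.succ_pos i)
              rcases mem_insert.mp (huT 0) with h2 | h2
              · exact absurd h1 (by rw [h2]; exact lt_irrefl _)
              · exact absurd h1 (hlt _ h2).not_gt
            · exact h
          rcases mem_insert.mp (huT 0) with h | h
          · rw [h, Function.update_self, ← hk (Fin.tail u)
              (fun i j hij => hu (Fin.succ_lt_succ_iff.mpr hij)) (fun i => hT (htail i)),
              ← h, Fin.cons_self_tail]
          · rw [Function.update_of_ne (hlt _ h).ne']
            exact hf u hu fun i => Fin.cases h htail i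
    obtain ⟨N, hN⟩ := key (Fintype.card κ * m)
    refine ⟨N, fun α _ S hS c => ?_⟩
    obtain ⟨T, hT, hTc, f, hf⟩ := hN α S hS c
    obtain ⟨k, -, hk⟩ := exists_le_card_fiber_of_mul_le_card_of_maps_to (s := T) (t := univ)
      (f := f) (n := m) (fun _ _ => mem_univ _) univ_nonempty (by rw [hTc, card_univ])
    obtain ⟨T', hT', hm⟩ := exists_subset_card_eq hk
    refine ⟨T', (hT'.trans (filter_subset _ _)).trans hT, hm, k, fun u hu huT => ?_⟩
    rw [hf u hu fun i => (mem_filter.mp (hT' (huT i))).1]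
    exact (mem_filter.mp (hT' (huT 0))).2

/-- A binary predicate is constant on the increasing pairs of `A`. -/
def UniformOnPairs {α : Type*} [LinearOrder α] (A : Finset α) (P : α → α → Prop) : Prop :=
  (∀ a ∈ A, ∀ b ∈ A, a < b → P a b) ∨ ∀ a ∈ A, ∀ b ∈ A, a < b → ¬ P a b

/-- A ternary predicate is constant on the increasing triples of `A`. -/
def UniformOnTriples {α : Type*} [LinearOrder α] (A : Finset α) (P : α → α → α → Prop) : Prop :=
  (∀ a ∈ A, ∀ b ∈ A, ∀ d ∈ A, a < b → b < d → P a b d) ∨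
    ∀ a ∈ A, ∀ b ∈ A, ∀ d ∈ A, a < b → b < d → ¬ P a b d

theorem UniformOnTriples.mono {α : Type*} [LinearOrder α] {A B : Finset α}
    {P : α → α → α → Prop} (h : UniformOnTriples A P) (hB : B ⊆ A) : UniformOnTriples B P := by
  rcases h with h | h
  · exact .inl fun a ha b hb d hd => h a (hB ha) b (hB hb) d (hB hd)
  · exact .inr fun a ha b hb d hd => h a (hB ha) b (hB hb) d (hB hd)

theorem exists_uniformOnPairs (m : ℕ) :
    ∃ N : ℕ, ∀ (α : Type) [LinearOrder α] (S : Finset α), N ≤ S.card →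
      ∀ P₁ P₂ P₃ : α → α → Prop, ∃ T ⊆ S, T.card = m ∧
        UniformOnPairs T P₁ ∧ UniformOnPairs T P₂ ∧ UniformOnPairs T P₃ := by
  -- The colours are triples of truth values, so all three predicates become uniform at once.
  obtain ⟨N, hN⟩ := exists_ramsey_tuple (κ := Prop × Prop × Prop) 2 m
  refine ⟨N, fun α _ S hS P₁ P₂ P₃ => ?_⟩
  obtain ⟨T, hT, hm, ⟨k₁, k₂, k₃⟩, hk⟩ :=
    hN α S hS fun u => (P₁ (u 0) (u 1), P₂ (u 0) (u 1), P₃ (u 0) (u 1))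
  have key : ∀ a ∈ T, ∀ b ∈ T, a < b → P₁ a b = k₁ ∧ P₂ a b = k₂ ∧ P₃ a b = k₃ := by
    intro a ha b hb hab
    have h := hk ![a, b] (by simpa [Fin.strictMono_iff_lt_succ] using hab)
      (by simp [Fin.forall_fin_two, ha, hb])
    exact ⟨congrArg Prod.fst h, congrArg (·.2.1) h, congrArg (·.2.2) h⟩
  refine ⟨T, hT, hm, ?_, ?_, ?_⟩
  · by_cases h : k₁
    · exact .inl fun a ha b hb hab => by simpa [(key a ha b hb hab).1] using h
    · exact .inr fun a ha b hb hab => by simpa [(key a ha b hb hab).1] using h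
  · by_cases h : k₂
    · exact .inl fun a ha b hb hab => by simpa [(key a ha b hb hab).2.1] using h
    · exact .inr fun a ha b hb hab => by simpa [(key a ha b hb hab).2.1] using h
  · by_cases h : k₃
    · exact .inl fun a ha b hb hab => by simpa [(key a ha b hb hab).2.2] using h
    · exact .inr fun a ha b hb hab => by simpa [(key a ha b hb hab).2.2] using h

theorem exists_uniformOnTriples (m : ℕ) :
    ∃ N : ℕ, ∀ (α : Type) [LinearOrder α] (S : Finset α), N ≤ S.card →
      ∀ P₁ P₂ P₃ : α → α → α → Prop, ∃ T ⊆ S, T.card = m ∧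
        UniformOnTriples T P₁ ∧ UniformOnTriples T P₂ ∧ UniformOnTriples T P₃ := by
  obtain ⟨N, hN⟩ := exists_ramsey_tuple (κ := Prop × Prop × Prop) 3 m
  refine ⟨N, fun α _ S hS P₁ P₂ P₃ => ?_⟩
  obtain ⟨T, hT, hm, ⟨k₁, k₂, k₃⟩, hk⟩ := hN α S hS
    fun u => (P₁ (u 0) (u 1) (u 2), P₂ (u 0) (u 1) (u 2), P₃ (u 0) (u 1) (u 2))
  have key : ∀ a ∈ T, ∀ b ∈ T, ∀ d ∈ T, a < b → b < d →
      P₁ a b d = k₁ ∧ P₂ a b d = k₂ ∧ P₃ a b d = k₃ := by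
    intro a ha b hb d hd hab hbd
    have h := hk ![a, b, d]
      (by simpa [Fin.strictMono_iff_lt_succ, Fin.forall_fin_two] using ⟨hab, hbd⟩)
      (by simp [Fin.forall_fin_succ, ha, hb, hd])
    exact ⟨congrArg Prod.fst h, congrArg (·.2.1) h, congrArg (·.2.2) h⟩
  refine ⟨T, hT, hm, ?_, ?_, ?_⟩
  · by_cases h : k₁
    · exact .inl fun a ha b hb d hd h1 h2 => by simpa [(key a ha b hb d hd h1 h2).1] using h
    · exact .inr fun a ha b hb d hd h1 h2 => by simpa [(key a ha b hb d hd h1 h2).1] using h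
  · by_cases h : k₂
    · exact .inl fun a ha b hb d hd h1 h2 => by simpa [(key a ha b hb d hd h1 h2).2.1] using h
    · exact .inr fun a ha b hb d hd h1 h2 => by simpa [(key a ha b hb d hd h1 h2).2.1] using h
  · by_cases h : k₃
    · exact .inl fun a ha b hb d hd h1 h2 => by simpa [(key a ha b hb d hd h1 h2).2.2] using h
    · exact .inr fun a ha b hb d hd h1 h2 => by simpa [(key a ha b hb d hd h1 h2).2.2] using h

/-! ### Monotone paths and closing them through a new vertex -/

/-- `w 0, …, w (m - 1)` is a path in `A` along which the edges increase with respect to `R`. -/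
structure IsMonotonePath {α : Type*} (R : Sym2 α → Sym2 α → Prop) (A : Finset α) (m : ℕ)
    (w : ℕ → α) : Prop where
  mem : ∀ i < m, w i ∈ A
  inj : ∀ i < m, ∀ j < m, w i = w j → i = j
  mono : ∀ i, i + 2 < m → R s(w i, w (i + 1)) s(w (i + 1), w (i + 2))

/-- `A` contains the vertices of a cycle of length `n` whose edges increase with respect to `R`. -/
def HasMonotoneCycle {α : Type*} (R : Sym2 α → Sym2 α → Prop) (A : Finset α) (n : ℕ) : Prop :=
  ∃ u : ℕ → α, IsMonotonePath R A n u ∧ R s(u (n - 2), u (n - 1)) s(u (n - 1), u 0)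

section Path

variable {α : Type*} [DecidableEq α] {R : Sym2 α → Sym2 α → Prop} {A : Finset α} {m : ℕ}
  {w : ℕ → α} {x : α}

/-- The two edges at `x` may both follow the path in the order (here), lie on either side of it
(`hasMonotoneCycle_cons`), or both precede it (`hasMonotoneCycle_rotate`). -/
theorem IsMonotonePath.hasMonotoneCycle_append (hw : IsMonotonePath R A (m + 2) w) (hx : x ∉ A)
    (h₁ : R s(w m, w (m + 1)) s(w (m + 1), x)) (h₂ : R s(w (m + 1), x) s(x, w 0)) :
    HasMonotoneCycle R (insert x A) (m + 3) := by
  have hne : ∀ i < m + 2, w i ≠ x := fun i hi h => hx (h ▸ hw.mem i hi)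
  refine ⟨fun i => if i = m + 2 then x else w i, ⟨fun i hi => ?_, fun i hi j hj h => ?_,
    fun i hi => ?_⟩, ?_⟩
  · split_ifs with h
    · exact mem_insert_self _ _
    · exact mem_insert_of_mem (hw.mem i (by omega))
  · split_ifs at h with h1 h2 h2
    · omega
    · exact absurd h.symm (hne j (by omega))
    · exact absurd h (hne i (by omega))
    · exact hw.inj i (by omega) j (by omega) h
  · rcases Nat.lt_or_ge i m with h | h
    · simpa [show i ≠ m + 2 by omega, show i ≠ m + 1 by omega, h.ne] using hw.mono i (by omega)
    · obtain rfl : i = m := by omega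
      simpa using h₁
  · simpa using h₂

theorem IsMonotonePath.hasMonotoneCycle_cons (hw : IsMonotonePath R A (m + 2) w) (hx : x ∉ A)
    (h₁ : R s(x, w 0) s(w 0, w 1)) (h₂ : R s(w m, w (m + 1)) s(w (m + 1), x)) :
    HasMonotoneCycle R (insert x A) (m + 3) := by
  have hne : ∀ i < m + 2, w i ≠ x := fun i hi h => hx (h ▸ hw.mem i hi)
  refine ⟨fun i => Nat.casesOn (motive := fun _ => α) i x w, ⟨?_, ?_, ?_⟩, h₂⟩
  · rintro (_ | i) hi
    · exact mem_insert_self _ _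
    · exact mem_insert_of_mem (hw.mem i (by omega))
  · rintro (_ | i) hi (_ | j) hj h
    · rfl
    · exact absurd h.symm (hne j (by omega))
    · exact absurd h (hne i (by omega))
    · rw [hw.inj i (by omega) j (by omega) h]
  · rintro (_ | i) hi
    · exact h₁
    · exact hw.mono i (by omega)

theorem IsMonotonePath.hasMonotoneCycle_rotate (hw : IsMonotonePath R A (m + 2) w) (hx : x ∉ A)
    (h₁ : R s(w (m + 1), x) s(x, w 0)) (h₂ : R s(x, w 0) s(w 0, w 1)) :
    HasMonotoneCycle R (insert x A) (m + 3) := by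
  have hne : ∀ i < m + 2, w i ≠ x := fun i hi h => hx (h ▸ hw.mem i hi)
  -- The cycle starts at the end of the path, so that the last edge of the path becomes the closing
  -- edge.
  refine ⟨fun i => Nat.casesOn (motive := fun _ => α) i (w (m + 1))
    fun j => Nat.casesOn (motive := fun _ => α) j x w, ⟨?_, ?_, ?_⟩, ?_⟩
  · rintro (_ | _ | i) hi
    · exact mem_insert_of_mem (hw.mem _ (by omega))
    · exact mem_insert_self _ _
    · exact mem_insert_of_mem (hw.mem i (by omega))
  · rintro (_ | _ | i) hi (_ | _ | j) hj h
    · rfl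
    · exact absurd h (hne _ (by omega))
    · have := hw.inj _ (by omega) j (by omega) h
      omega
    · exact absurd h.symm (hne _ (by omega))
    · rfl
    · exact absurd h.symm (hne j (by omega))
    · have := hw.inj i (by omega) _ (by omega) h
      omega
    · exact absurd h (hne i (by omega))
    · rw [hw.inj i (by omega) j (by omega) h]
  · rintro (_ | _ | i) hi
    · exact h₁
    · exact h₂
    · exact hw.mono i (by omega)
  · rcases m with _ | m
    · exact h₂
    · exact hw.mono m (by omega)

end Path

/-- Alternating between two sequences yields a monotone path, provided that the edges at each
vertex of one sequence increase along the other one. -/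
theorem exists_alternating_path {α : Type*} {R : Sym2 α → Sym2 α → Prop} {A : Finset α} {k : ℕ}
    {f g : ℕ → α} (hf : ∀ i < k, f i ∈ A) (hg : ∀ i < k, g i ∈ A)
    (hf' : ∀ i < k, ∀ j < k, f i = f j → i = j) (hg' : ∀ i < k, ∀ j < k, g i = g j → i = j)
    (hfg : ∀ i < k, ∀ j < k, f i ≠ g j)
    (h₁ : ∀ l < k, ∀ i j, i < j → j < k → R s(f l, g i) s(f l, g j))
    (h₂ : ∀ l < k, ∀ i j, i < j → j < k → R s(g l, f i) s(g l, f j)) :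
    ∃ w : ℕ → α, IsMonotonePath R A (2 * k) w ∧ (∀ i, w (2 * i) = f i) ∧
      ∀ i, w (2 * i + 1) = g i := by
  have h0 : ∀ i, (2 * i + 1) / 2 = i := fun i => by omega
  obtain ⟨w, hw₀, hw₁⟩ : ∃ w : ℕ → α, (∀ i, w (2 * i) = f i) ∧ ∀ i, w (2 * i + 1) = g i :=
    ⟨fun i => if i % 2 = 0 then f (i / 2) else g (i / 2), fun i => by simp,
      fun i => by simp [h0]⟩
  refine ⟨w, ⟨fun i hi => ?_, fun i hi j hj h => ?_, fun i hi => ?_⟩, hw₀, hw₁⟩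
  · rcases Nat.even_or_odd' i with ⟨a, rfl | rfl⟩
    · rw [hw₀]; exact hf a (by omega)
    · rw [hw₁]; exact hg a (by omega)
  · rcases Nat.even_or_odd' i with ⟨a, rfl | rfl⟩ <;> rcases Nat.even_or_odd' j with ⟨b, rfl | rfl⟩
    · rw [hw₀, hw₀] at h; rw [hf' a (by omega) b (by omega) h]
    · rw [hw₀, hw₁] at h; exact absurd h (hfg a (by omega) b (by omega))
    · rw [hw₀, hw₁] at h; exact absurd h.symm (hfg b (by omega) a (by omega))
    · rw [hw₁, hw₁] at h; rw [hg' a (by omega) b (by omega) h]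
  · rcases Nat.even_or_odd' i with ⟨a, rfl | rfl⟩
    · rw [show 2 * a + 2 = 2 * (a + 1) by ring, hw₀, hw₀, hw₁, Sym2.eq_swap]
      exact h₂ a (by omega) a (a + 1) (by omega) (by omega)
    · rw [show 2 * a + 1 + 1 = 2 * (a + 1) by ring, show 2 * a + 1 + 2 = 2 * (a + 1) + 1 by ring,
        hw₀, hw₁, hw₁, Sym2.eq_swap]
      exact h₁ (a + 1) (by omega) a (a + 1) (by omega) (by omega)

/-! ### Zigzag paths and absorption of one vertex -/

section Order

variable {α : Type*} [LinearOrder α] {R : Sym2 α → Sym2 α → Prop} {A : Finset α} {k : ℕ}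

/-- A set of size `2 * k` in which the comparisons of edges sharing their smallest or their largest
vertex are uniform splits into a lower half and an upper half which can be enumerated such
that the edges at each vertex of one half increase along the other half. -/
theorem exists_lower_upper
    (hR : ∀ a b d : α, a ≠ b → a ≠ d → b ≠ d → ¬ R s(a, b) s(a, d) → R s(a, d) s(a, b))
    (hk : 0 < k) (hA : A.card = 2 * k)
    (hmin : UniformOnTriples A fun a b d => R s(a, b) s(a, d))
    (hmax : UniformOnTriples A fun a b d => R s(d, a) s(d, b)) :
    ∃ f g : ℕ → α, (∀ i < k, f i ∈ A) ∧ (∀ i < k, g i ∈ A) ∧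
      (∀ i < k, ∀ j < k, f i = f j → i = j) ∧ (∀ i < k, ∀ j < k, g i = g j → i = j) ∧
      (∀ i < k, ∀ j < k, f i < g j) ∧
      (∀ l < k, ∀ i j, i < j → j < k → R s(f l, g i) s(f l, g j)) ∧
      (∀ l < k, ∀ i j, i < j → j < k → R s(g l, f i) s(g l, f j)) := by
  obtain ⟨e, heA, hlt⟩ : ∃ e : ℕ → α, (∀ i < 2 * k, e i ∈ A) ∧
      ∀ i j, i < j → j < 2 * k → e i < e j := by
    refine ⟨fun i => A.orderEmbOfFin hA ⟨i % (2 * k), Nat.mod_lt _ (by omega)⟩,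
      fun i _ => orderEmbOfFin_mem _ _ _, fun i j hij hj => ?_⟩
    simp [Nat.mod_eq_of_lt hj, Nat.mod_eq_of_lt (hij.trans hj), hij]
  have hinj : ∀ i < 2 * k, ∀ j < 2 * k, e i = e j → i = j := fun i hi j hj h => by
    rcases lt_trichotomy i j with h' | h' | h'
    · exact absurd h (hlt i j h' hj).ne
    · exact h'
    · exact absurd h (hlt j i h' hi).ne'
  -- An upper vertex is the largest in its triangles with two lower ones, so `hmax` decides whether
  -- the lower half is listed forwards or backwards. Dually, `hmin` decides the order `τ` of the
  -- upper half.
  obtain ⟨σ, hσ, hσ', hσR⟩ : ∃ σ : ℕ → ℕ, (∀ i < k, σ i < k) ∧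
      (∀ i < k, ∀ j < k, σ i = σ j → i = j) ∧
      ∀ l, k ≤ l → l < 2 * k → ∀ i j, i < j → j < k →
        R s(e l, e (σ i)) s(e l, e (σ j)) := by
    rcases hmax with h | h
    · exact ⟨id, fun i hi => hi, fun i _ j _ h => h, fun l hl hl' i j hij hj =>
        h _ (heA _ (by grind)) _ (heA _ (by grind)) _ (heA l hl')
          (hlt _ _ hij (by grind)) (hlt _ _ (by grind) hl')⟩
    · refine ⟨fun i => k - 1 - i, fun i hi => by grind, fun i _ j _ h => by grind,
        fun l hl hl' i j hij hj => ?_⟩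
      have h1 := hlt (k - 1 - j) (k - 1 - i) (by grind) (by grind)
      have h2 := hlt (k - 1 - i) l (by grind) hl'
      exact hR _ _ _ (h1.trans h2).ne' h2.ne' h1.ne
        (h _ (heA _ (by grind)) _ (heA _ (by grind)) _ (heA l hl') h1 h2)
  obtain ⟨τ, hτ, hτ', hτR⟩ : ∃ τ : ℕ → ℕ, (∀ i < k, k ≤ τ i ∧ τ i < 2 * k) ∧
      (∀ i < k, ∀ j < k, τ i = τ j → i = j) ∧
      ∀ l < k, ∀ i j, i < j → j < k → R s(e l, e (τ i)) s(e l, e (τ j)) := by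
    rcases hmin with h | h
    · exact ⟨fun i => k + i, fun i hi => by grind, fun i _ j _ h => by grind,
        fun l hl i j hij hj => h _ (heA _ (by grind)) _ (heA _ (by grind)) _ (heA _ (by grind))
          (hlt _ _ (by grind) (by grind)) (hlt _ _ (by grind) (by grind))⟩
    · refine ⟨fun i => 2 * k - 1 - i, fun i hi => by grind, fun i _ j _ h => by grind,
        fun l hl i j hij hj => ?_⟩
      have h1 := hlt l (2 * k - 1 - j) (by grind) (by grind)
      have h2 := hlt (2 * k - 1 - j) (2 * k - 1 - i) (by grind) (by grind)
      exact hR _ _ _ h1.ne (h1.trans h2).ne h2.ne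
        (h _ (heA _ (by grind)) _ (heA _ (by grind)) _ (heA _ (by grind)) h1 h2)
  refine ⟨fun i => e (σ i), fun i => e (τ i), fun i hi => heA _ ?_, fun i hi => heA _ (hτ i hi).2,
    fun i hi j hj h => hσ' i hi j hj (hinj _ ?_ _ ?_ h),
    fun i hi j hj h => hτ' i hi j hj (hinj _ (hτ i hi).2 _ (hτ j hj).2 h),
    fun i hi j hj => hlt _ _ ?_ (hτ j hj).2, fun l hl => hτR _ (hσ l hl),
    fun l hl => hσR _ (hτ l hl).1 (hτ l hl).2⟩
  · have := hσ i hi; omega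
  · have := hσ i hi; omega
  · have := hσ j hj; omega
  · have := hσ i hi; have := hτ j hj; omega

/-- If `A` has even size `2 * k` and both the comparisons of adjacent edges in `A` and those of
adjacent edges in triangles through `x` are uniform, then `x` and `A` span a monotone cycle. -/
theorem hasMonotoneCycle_insert
    (hR : ∀ a b d : α, a ≠ b → a ≠ d → b ≠ d → ¬ R s(a, b) s(a, d) → R s(a, d) s(a, b))
    (hk : 0 < k) (hA : A.card = 2 * k) {x : α} (hx : x ∉ A)
    (hmin : UniformOnTriples A fun a b d => R s(a, b) s(a, d))
    (hmax : UniformOnTriples A fun a b d => R s(d, a) s(d, b))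
    (h₁ : UniformOnPairs A fun a b => R s(x, a) s(x, b))
    (h₂ : UniformOnPairs A fun a b => R s(a, x) s(a, b))
    (h₃ : UniformOnPairs A fun a b => R s(b, x) s(b, a)) :
    HasMonotoneCycle R (insert x A) (2 * k + 1) := by
  obtain ⟨f, g, hf, hg, hf', hg', hfg, hfR, hgR⟩ := exists_lower_upper hR hk hA hmin hmax
  obtain ⟨w, hw, hwf, hwg⟩ := exists_alternating_path hf hg hf' hg'
    (fun i hi j hj => (hfg i hi j hj).ne) hfR hgR
  obtain ⟨v, hv, hvg, hvf⟩ := exists_alternating_path hg hf hg' hf'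
    (fun i hi j hj => (hfg j hj i hi).ne') hgR hfR
  obtain ⟨k, rfl⟩ : ∃ l, k = l + 1 := ⟨k - 1, by omega⟩
  have hwfg : ∀ i ≤ k, ∀ j ≤ k, w (2 * i) < w (2 * j + 1) := fun i hi j hj => by
    rw [hwf, hwg]; exact hfg i (by omega) j (by omega)
  have hvfg : ∀ i ≤ k, ∀ j ≤ k, v (2 * j + 1) < v (2 * i) := fun i hi j hj => by
    rw [hvf, hvg]; exact hfg j (by omega) i (by omega)
  rw [Nat.mul_succ] at hw hv ⊢
  have hw0 := hwfg 0 (by omega) 0 (by omega)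
  have hwk := hwfg k le_rfl k le_rfl
  have hwc := hwfg 0 (by omega) k le_rfl
  have hv0 := hvfg 0 (by omega) 0 (by omega)
  have hvk := hvfg k le_rfl k le_rfl
  have hvc := hvfg 0 (by omega) k le_rfl
  simp only [Nat.mul_zero, Nat.zero_add] at hw0 hwc hv0 hvc
  have mw : ∀ i < 2 * k + 2, w i ∈ A := hw.mem
  have mv : ∀ i < 2 * k + 2, v i ∈ A := hv.mem
  have hxA : ∀ a ∈ A, a ≠ x := fun a ha h => hx (h ▸ ha)
  have h₁' : ∀ a ∈ A, ∀ b ∈ A, a < b → ¬ R s(x, a) s(x, b) → R s(x, b) s(x, a) :=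
    fun a ha b hb hab => hR _ _ _ (hxA a ha).symm (hxA b hb).symm hab.ne
  have h₂' : ∀ a ∈ A, ∀ b ∈ A, a < b → ¬ R s(a, x) s(a, b) → R s(a, b) s(a, x) :=
    fun a ha b hb hab => hR _ _ _ (hxA a ha) hab.ne (hxA b hb).symm
  have h₃' : ∀ a ∈ A, ∀ b ∈ A, a < b → ¬ R s(b, x) s(b, a) → R s(b, a) s(b, x) :=
    fun a ha b hb hab => hR _ _ _ (hxA b hb) hab.ne' (hxA a ha).symm
  have w0 := mw 0 (by omega)
  have w1 := mw 1 (by omega)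
  have wk := mw (2 * k) (by omega)
  have wl := mw (2 * k + 1) (by omega)
  have v0 := mv 0 (by omega)
  have v1 := mv 1 (by omega)
  have vk := mv (2 * k) (by omega)
  have vl := mv (2 * k + 1) (by omega)
  -- The path `w` runs from the lower to the upper half, `v` from the upper to the lower. If edges
  -- at `x` increase, `v` closes by rotation when `h₃` is positive and by appending when `h₂` is
  -- negative; in the remaining case `w` closes with `x` in front. If they decrease, `v` and `w`
  -- swap roles, as do `h₂` and `h₃`.
  rcases h₁ with h₁ | h₁
  · rcases h₂ with h₂ | h₂
    · rcases h₃ with h₃ | h₃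
      · refine hv.hasMonotoneCycle_rotate hx ?_ ?_
        · rw [Sym2.eq_swap]; exact h₁ _ vl _ v0 hvc
        · rw [Sym2.eq_swap]; exact h₃ _ v1 _ v0 hv0
      · refine hw.hasMonotoneCycle_cons hx ?_ ?_
        · rw [Sym2.eq_swap]; exact h₂ _ w0 _ w1 hw0
        · rw [Sym2.eq_swap]; exact h₃' _ wk _ wl hwk (h₃ _ wk _ wl hwk)
    · refine hv.hasMonotoneCycle_append hx ?_ ?_
      · rw [Sym2.eq_swap]; exact h₂' _ vl _ vk hvk (h₂ _ vl _ vk hvk)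
      · rw [Sym2.eq_swap]; exact h₁ _ vl _ v0 hvc
  · rcases h₃ with h₃ | h₃
    · rcases h₂ with h₂ | h₂
      · refine hw.hasMonotoneCycle_rotate hx ?_ ?_
        · rw [Sym2.eq_swap]; exact h₁' _ w0 _ wl hwc (h₁ _ w0 _ wl hwc)
        · rw [Sym2.eq_swap]; exact h₂ _ w0 _ w1 hw0
      · refine hv.hasMonotoneCycle_cons hx ?_ ?_
        · rw [Sym2.eq_swap]; exact h₃ _ v1 _ v0 hv0
        · rw [Sym2.eq_swap]; exact h₂' _ vl _ vk hvk (h₂ _ vl _ vk hvk)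
    · refine hw.hasMonotoneCycle_append hx ?_ ?_
      · rw [Sym2.eq_swap]; exact h₃' _ wk _ wl hwk (h₃ _ wk _ wl hwk)
      · rw [Sym2.eq_swap]; exact h₁' _ w0 _ wl hwc (h₁ _ w0 _ wl hwc)

/-- All comparisons of the edges of triangles in `A` are uniform. -/
def IsHomogeneous (R : Sym2 α → Sym2 α → Prop) (A : Finset α) : Prop :=
  UniformOnTriples A (fun a b d => R s(a, b) s(a, d)) ∧
    UniformOnTriples A (fun a b d => R s(d, a) s(d, b)) ∧
      UniformOnTriples A fun a b d => R s(b, a) s(b, d)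

theorem IsHomogeneous.mono {B : Finset α} (h : IsHomogeneous R A) (hB : B ⊆ A) :
    IsHomogeneous R B :=
  ⟨h.1.mono hB, h.2.1.mono hB, h.2.2.mono hB⟩

/-- The minimum of `A` plays the part of the absorbed vertex: its triangles with the other vertices
are uniform by homogeneity. -/
theorem IsHomogeneous.hasMonotoneCycle
    (hR : ∀ a b d : α, a ≠ b → a ≠ d → b ≠ d → ¬ R s(a, b) s(a, d) → R s(a, d) s(a, b))
    (h : IsHomogeneous R A) (hk : 0 < k) (hA : A.card = 2 * k + 1) :
    HasMonotoneCycle R A (2 * k + 1) := by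
  have hne : A.Nonempty := card_pos.mp (by omega)
  have hxA := A.min'_mem hne
  have hlt : ∀ a ∈ A.erase (A.min' hne), a ∈ A ∧ A.min' hne < a := fun a ha =>
    ⟨(mem_erase.mp ha).2, A.min'_lt_of_mem_erase_min' hne ha⟩
  have h' := h.mono (A.erase_subset (A.min' hne))
  rw [← insert_erase hxA]
  refine hasMonotoneCycle_insert hR hk (by rw [card_erase_of_mem hxA, hA]; rfl)
    (notMem_erase _ _) h'.1 h'.2.1 ?_ ?_ ?_
  · exact h.1.imp (fun h a ha b hb => h _ hxA a (hlt a ha).1 b (hlt b hb).1 (hlt a ha).2)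
      (fun h a ha b hb => h _ hxA a (hlt a ha).1 b (hlt b hb).1 (hlt a ha).2)
  · exact h.2.2.imp (fun h a ha b hb => h _ hxA a (hlt a ha).1 b (hlt b hb).1 (hlt a ha).2)
      (fun h a ha b hb => h _ hxA a (hlt a ha).1 b (hlt b hb).1 (hlt a ha).2)
  · exact h.2.1.imp (fun h a ha b hb => h _ hxA a (hlt a ha).1 b (hlt b hb).1 (hlt a ha).2)
      (fun h a ha b hb => h _ hxA a (hlt a ha).1 b (hlt b hb).1 (hlt a ha).2)

end Order

/-! ### Tilings of finite sets -/

/-- `A` is a disjoint union of finsets satisfying `P`. -/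
inductive IsTiled {α : Type*} [DecidableEq α] (P : Finset α → Prop) : Finset α → Prop
  | empty : IsTiled P ∅
  | union {A B : Finset α} : IsTiled P A → P B → Disjoint A B → IsTiled P (A ∪ B)

namespace IsTiled

variable {α : Type*} [DecidableEq α] {P : Finset α → Prop} {A B : Finset α}

theorem disjoint_union (hA : IsTiled P A) (hB : IsTiled P B) (h : Disjoint A B) :
    IsTiled P (A ∪ B) := by
  induction hB with
  | empty => simpa using hA
  | @union B C _ hC hBC ih =>
    rw [disjoint_union_right] at h
    rw [← union_assoc]
    exact (ih h.1).union hC (disjoint_union_left.mpr ⟨h.2, hBC⟩)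

theorem dvd_card {n : ℕ} (hP : ∀ B, P B → B.card = n) (hA : IsTiled P A) : n ∣ A.card := by
  induction hA with
  | empty => simp
  | union _ hB h ih => rw [card_union_of_disjoint h, hP _ hB]; exact ih.add (dvd_refl n)

/-- If every large finset contains a tile, then all but few elements can be tiled greedily. -/
theorem exists_subset {n N : ℕ} (hn : 0 < n)
    (hP : ∀ B, P B → B.card = n) (hN : ∀ S : Finset α, N ≤ S.card → ∃ B ⊆ S, P B)
    (S : Finset α) : ∃ A ⊆ S, IsTiled P A ∧ (S \ A).card < N := by
  induction hc : S.card using Nat.strong_induction_on generalizing S with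
  | _ c ih =>
    by_cases h : S.card < N
    · exact ⟨∅, empty_subset _, .empty, by simpa using h⟩
    · obtain ⟨B, hBS, hB⟩ := hN S (not_lt.mp h)
      have := card_sdiff_add_card_eq_card hBS
      have := hP B hB
      obtain ⟨A, hAS, hA, hlt⟩ := ih (S \ B).card (by omega) (S \ B) rfl
      refine ⟨A ∪ B, union_subset (hAS.trans sdiff_subset) hBS,
        hA.union hB (disjoint_sdiff_self_left.mono_left hAS), ?_⟩
      rwa [union_comm, ← sup_eq_union, ← sdiff_sdiff_left]

/-- If `A` is hereditarily rich in tiles through any given outside element, then a small set can be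
covered by tiles which otherwise use elements of `A` only. -/
theorem exists_cover {m N : ℕ}
    (hN : ∀ x, x ∉ A → ∀ S ⊆ A, N ≤ S.card → ∃ B ⊆ S, B.card = m ∧ P (insert x B))
    (L : Finset α) : Disjoint L A → ∀ S ⊆ A, L.card * m + N ≤ S.card →
      ∃ B ⊆ S, IsTiled P (L ∪ B) := by
  induction L using Finset.induction_on with
  | empty => exact fun _ S _ _ => ⟨∅, empty_subset _, by simpa using IsTiled.empty⟩
  | @insert x L hxL ih =>
    intro hd S hSA hS
    rw [disjoint_insert_left] at hd
    rw [card_insert_of_notMem hxL, Nat.succ_mul] at hS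
    obtain ⟨B, hBS, hBm, hB⟩ := hN x hd.1 S hSA (by omega)
    have := card_sdiff_add_card_eq_card hBS
    -- Removing `B` costs `m` vertices, the share reserved for `x` in `L.card * m + N`.
    obtain ⟨C, hCS, hC⟩ := ih hd.2 (S \ B) (sdiff_subset.trans hSA) (by omega)
    refine ⟨C ∪ B, union_subset (hCS.trans sdiff_subset) hBS, ?_⟩
    have hCA : C ⊆ A := hCS.trans (sdiff_subset.trans hSA)
    convert hC.union hB ?_ using 1
    · grind
    · rw [disjoint_insert_right, disjoint_union_left, mem_union, not_or]
      exact ⟨⟨hxL, fun h => hd.1 (hCA h)⟩, hd.2.mono_right (hBS.trans hSA),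
        disjoint_sdiff_self_left.mono_left hCS⟩

theorem of_dvd_card {n : ℕ} (hP : ∀ B ⊆ A, B.card = n → P B) (h : n ∣ A.card) :
    IsTiled P A := by
  obtain ⟨q, hq⟩ := h
  induction q generalizing A with
  | zero => rw [mul_zero, card_eq_zero] at hq; subst hq; exact .empty
  | succ q ih =>
    obtain ⟨B, hBA, hB⟩ := exists_subset_card_eq (s := A) (n := n) (by rw [hq, Nat.mul_succ]; omega)
    have := card_sdiff_add_card_eq_card hBA
    rw [← sdiff_union_of_subset hBA]
    refine (ih (fun C hC => hP C (hC.trans sdiff_subset)) ?_).union (hP B hBA hB)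
      disjoint_sdiff_self_left
    rw [Nat.mul_succ] at hq
    omega

end IsTiled

/-! ### Assembling the tiling -/

/-- Every sufficiently large complete graph with compared edges, of order divisible by the odd
number `2 * k + 1`, is tiled by monotone cycles of length `2 * k + 1`. -/
theorem exists_forall_isTiled_hasMonotoneCycle {k : ℕ} (hk : 0 < k) :
    ∃ t : ℕ, 0 < t ∧ 2 * k + 1 ∣ t ∧ ∀ (α : Type) [LinearOrder α] [Fintype α],
      Fintype.card α = t → ∀ R : Sym2 α → Sym2 α → Prop,
      (∀ a b d : α, a ≠ b → a ≠ d → b ≠ d → ¬ R s(a, b) s(a, d) → R s(a, d) s(a, b)) →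
      IsTiled (fun B => B.card = 2 * k + 1 ∧ HasMonotoneCycle R B (2 * k + 1))
        (univ : Finset α) := by
  obtain ⟨N₂, hN₂⟩ := exists_uniformOnPairs (2 * k)
  obtain ⟨N₃, hN₃⟩ := exists_uniformOnTriples (2 * k + 1)
  -- Fewer than `N₃` vertices survive the greedy tiling. Each uses up `2 * k` vertices of `A`, and
  -- `N₂` must remain available throughout.
  obtain ⟨M, hM⟩ := exists_uniformOnTriples (N₃ * (2 * k) + N₂)
  refine ⟨(2 * k + 1) * (M + 1), by positivity, dvd_mul_right _ _, fun α _ _ hα R hR => ?_⟩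
  set P : Finset α → Prop := fun B => B.card = 2 * k + 1 ∧ HasMonotoneCycle R B (2 * k + 1)
  have hPc : ∀ B, P B → B.card = 2 * k + 1 := fun B hB => hB.1
  have hom : ∀ B, IsHomogeneous R B → B.card = 2 * k + 1 → P B :=
    fun B hB hc => ⟨hc, hB.hasMonotoneCycle hR hk hc⟩
  obtain ⟨A, -, hAc, hA⟩ := hM α univ (by rw [card_univ, hα]; nlinarith)
    (fun a b d => R s(a, b) s(a, d)) (fun a b d => R s(d, a) s(d, b))
    (fun a b d => R s(b, a) s(b, d))
  obtain ⟨S, hSA, hS, hlt⟩ := IsTiled.exists_subset (P := P) (N := N₃) (by omega) hPc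
    (fun S hS => by
      obtain ⟨B, hBS, hBc, hB⟩ := hN₃ α S hS
        (fun a b d => R s(a, b) s(a, d)) (fun a b d => R s(d, a) s(d, b))
        (fun a b d => R s(b, a) s(b, d))
      exact ⟨B, hBS, hom B hB hBc⟩) (univ \ A)
  set L := (univ \ A) \ S
  have hLA : Disjoint L A := disjoint_sdiff_self_left.mono_left sdiff_subset
  obtain ⟨B, hBA, hB⟩ := IsTiled.exists_cover (P := P) (A := A) (m := 2 * k) (N := N₂)
    (fun x hx T hTA hT => by
      obtain ⟨B, hBT, hBc, h₁, h₂, h₃⟩ := hN₂ α T hT (fun a b => R s(x, a) s(x, b))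
        (fun a b => R s(a, x) s(a, b)) (fun a b => R s(b, x) s(b, a))
      have hxB : x ∉ B := fun h => hx (hTA (hBT h))
      have hB := IsHomogeneous.mono hA (hBT.trans hTA)
      exact ⟨B, hBT, hBc, by rw [card_insert_of_notMem hxB, hBc],
        hasMonotoneCycle_insert hR hk hBc hxB hB.1 hB.2.1 h₁ h₂ h₃⟩) L hLA A subset_rfl
    (by rw [hAc]; gcongr)
  have hSLB : IsTiled P (S ∪ (L ∪ B)) := hS.disjoint_union hB <| disjoint_union_right.mpr
    ⟨disjoint_sdiff_self_right, disjoint_sdiff_self_left.mono hSA hBA⟩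
  have hdisj : Disjoint (S ∪ (L ∪ B)) (A \ B) := by
    rw [disjoint_union_left, disjoint_union_left]
    exact ⟨disjoint_sdiff_self_left.mono hSA sdiff_subset, hLA.mono_right sdiff_subset,
      disjoint_sdiff_self_right⟩
  have huniv : S ∪ (L ∪ B) ∪ (A \ B) = univ := by
    ext a
    simp only [L, mem_union, mem_sdiff, mem_univ, true_and, iff_true]
    tauto
  have hcard := card_union_of_disjoint hdisj
  rw [huniv, card_univ, hα] at hcard
  rw [← huniv]
  refine hSLB.disjoint_union (IsTiled.of_dvd_card (n := 2 * k + 1)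
    (fun C hC hCc => hom C (IsHomogeneous.mono hA (hC.trans sdiff_subset)) hCc) ?_) hdisj
  exact (Nat.dvd_add_right (hSLB.dvd_card hPc)).mp (hcard ▸ dvd_mul_right _ _)

/-! ### Transfer to edge-ordered graphs -/

namespace EdgeOrderedGraph

theorem Less.trans {V : Type*} {F : EdgeOrderedGraph V} {e₁ e₂ e₃ : Sym2 V} :
    F.Less e₁ e₂ → F.Less e₂ e₃ → F.Less e₁ e₃
  | ⟨h₁, _, h⟩, ⟨_, h₃, h'⟩ => ⟨h₁, h₃, @lt_trans _ F.edgeOrder.toPreorder _ _ _ h h'⟩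

theorem Less.irrefl {V : Type*} {F : EdgeOrderedGraph V} {e : Sym2 V} : ¬ F.Less e e :=
  fun ⟨_, _, h⟩ => @lt_irrefl _ F.edgeOrder.toPreorder _ h

theorem less_of_not_less {V : Type*} {F : EdgeOrderedGraph V} {e₁ e₂ : Sym2 V}
    (h₁ : e₁ ∈ F.graph.edgeSet) (h₂ : e₂ ∈ F.graph.edgeSet) (hne : e₁ ≠ e₂)
    (h : ¬ F.Less e₁ e₂) : F.Less e₂ e₁ := by
  rcases @lt_trichotomy _ F.edgeOrder ⟨e₁, h₁⟩ ⟨e₂, h₂⟩ with h' | h' | h'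
  · exact absurd ⟨h₁, h₂, h'⟩ h
  · exact absurd (congrArg Subtype.val h') hne
  · exact ⟨h₂, h₁, h'⟩

/-- A monotone cycle in a complete graph gives a copy of any edge-ordered monotone cycle of the
same length. -/
theorem IsMonotoneCycle.exists_embedding {V W : Type*} {F : EdgeOrderedGraph V} {n : ℕ}
    (hF : F.IsMonotoneCycle n) (o : LinearOrder (⊤ : SimpleGraph W).edgeSet) {B : Finset W}
    (hBc : B.card = n) (hB : HasMonotoneCycle (EdgeOrderedGraph.Less ⟨⊤, o⟩) B n) :
    ∃ φ : F.Embedding ⟨⊤, o⟩, Set.range φ.toHom = B := by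
  classical
  obtain ⟨hn, u, hu⟩ := hF
  obtain ⟨v, hv, hlast⟩ := hB
  obtain ⟨n, rfl⟩ : ∃ l, n = l + 2 := ⟨n - 2, by omega⟩
  let p : Fin (n + 2) → W := fun i => v i
  have hp : Function.Injective p := fun i j h => Fin.ext (hv.inj i i.2 j j.2 h)
  have hstep : ∀ i : Fin (n + 1), EdgeOrderedGraph.Less ⟨⊤, o⟩
      s(p i.castSucc, p (finRotate _ i.castSucc)) s(p i.succ, p (finRotate _ i.succ)) := by
    intro i
    rw [finRotate_apply, finRotate_apply, Fin.coeSucc_eq_succ]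
    rcases Fin.eq_castSucc_or_eq_last i with ⟨j, rfl⟩ | rfl
    · rw [← Fin.castSucc_succ, Fin.coeSucc_eq_succ]
      exact hv.mono j (by omega)
    · rw [Fin.succ_last, Fin.last_add_one]
      exact hlast
  -- Transitivity of the edge order enters only here; the construction of cycles compares adjacent
  -- edges alone.
  have hmono : ∀ i j : Fin (n + 2), i < j → EdgeOrderedGraph.Less ⟨⊤, o⟩
      s(p i, p (finRotate _ i)) s(p j, p (finRotate _ j)) := by
    intro i j
    induction j using Fin.induction with
    | zero => exact fun h => absurd h (Fin.not_lt_zero _)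
    | succ j ih =>
      intro h
      rcases (Fin.le_castSucc_iff.mpr h).lt_or_eq with h' | rfl
      · exact (ih h').trans (hstep j)
      · exact hstep j
  have hedge : ∀ e ∈ F.graph.edgeSet, ∃ i, e = s(u i, u (finRotate _ i)) := by
    intro e
    induction e using Sym2.ind with
    | _ a b =>
      intro h
      obtain ⟨i, rfl⟩ := u.surjective a
      obtain ⟨j, rfl⟩ := u.surjective b
      rw [SimpleGraph.mem_edgeSet, u.map_adj_iff, SimpleGraph.cycleGraph_adj] at h
      rcases h with h | h
      · refine ⟨j, ?_⟩
        rw [finRotate_apply, ← h, add_sub_cancel, Sym2.eq_swap]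
      · refine ⟨i, ?_⟩
        rw [finRotate_apply, ← h, add_sub_cancel]
  let q : V → W := fun a => p (u.symm a)
  have hq : Function.Injective q := hp.comp u.symm.injective
  have hqu : ∀ i, q (u i) = p i := fun i => by simp [q]
  refine ⟨⟨⟨⟨q, fun {a b} h => hq.ne h.ne⟩, hq⟩, fun e₁ e₂ h => ?_⟩, ?_⟩
  · obtain ⟨i, rfl⟩ := hedge e₁ h.1
    obtain ⟨j, rfl⟩ := hedge e₂ h.2.1
    -- The order on the edges of `F` is strict and follows the indices, so it also determines them.
    have hij : i < j := by
      rcases lt_trichotomy i j with h' | rfl | h'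
      · exact h'
      · exact absurd h Less.irrefl
      · exact absurd (h.trans (hu j i h')) Less.irrefl
    simpa [hqu] using hmono i j hij
  · change Set.range q = B
    have h : Finset.univ.image p = B := by
      refine eq_of_subset_of_card_le (fun x hx => ?_) ?_
      · obtain ⟨i, -, rfl⟩ := mem_image.mp hx
        exact hv.mem i i.2
      · rw [card_image_of_injective _ hp, hBc, card_univ, Fintype.card_fin]
    rw [← h, coe_image, coe_univ, Set.image_univ]
    exact u.symm.surjective.range_comp p

theorem hasPerfectTiling_of_isTiled {V W : Type*} [DecidableEq W] {F : EdgeOrderedGraph V}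
    {H : EdgeOrderedGraph W} {P : Finset W → Prop}
    (hP : ∀ B, P B → ∃ φ : F.Embedding H, Set.range φ.toHom = B) {A : Finset W}
    (hA : IsTiled P A) : ∃ T : Set (F.Embedding H),
      T.PairwiseDisjoint (fun φ => Set.range φ.toHom) ∧ (⋃ φ ∈ T, Set.range φ.toHom) = A := by
  induction hA with
  | empty => exact ⟨∅, by simp, by simp⟩
  | @union A B _ hB hd ih =>
    obtain ⟨T, hT, hTA⟩ := ih
    obtain ⟨φ, hφ⟩ := hP B hB
    refine ⟨insert φ T, hT.insert fun ψ hψ _ => ?_, ?_⟩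
    · have h : Set.range ψ.toHom ⊆ (A : Set W) :=
        hTA ▸ Set.subset_biUnion_of_mem (u := fun φ : F.Embedding H => Set.range φ.toHom) hψ
      change Disjoint (Set.range φ.toHom) (Set.range ψ.toHom)
      rw [hφ]
      exact (disjoint_coe.mpr hd.symm).mono_right h
    · rw [Set.biUnion_insert, hTA, hφ, coe_union, Set.union_comm]

end EdgeOrderedGraph

theorem proposition2p18 {V : Type*} [Fintype V] (F : EdgeOrderedGraph V) (n : ℕ) (hn : Odd n)
    (hF : F.IsMonotoneCycle n) : F.Tileable := by
  obtain ⟨k, rfl⟩ := hn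
  obtain ⟨h3, u, -⟩ := id hF
  obtain ⟨t, ht, hdvd, h⟩ := exists_forall_isTiled_hasMonotoneCycle (k := k) (by omega)
  have hV : Fintype.card V = 2 * k + 1 := by
    rw [← Fintype.card_congr u.toEquiv, Fintype.card_fin]
  refine ⟨t, ht, hV ▸ hdvd, fun o => ?_⟩
  obtain ⟨T, hT, hTu⟩ := EdgeOrderedGraph.hasPerfectTiling_of_isTiled
    (fun B hB => hF.exists_embedding o hB.1 hB.2)
    (h (Fin t) (Fintype.card_fin t) (EdgeOrderedGraph.Less ⟨⊤, o⟩) fun a b d hab had hbd =>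
      EdgeOrderedGraph.less_of_not_less (by simpa using hab) (by simpa using had)
        (by simpa [hbd] using fun h => absurd h had))
  exact ⟨T, hT, by simpa using hTu⟩
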